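/- Let $E\to M$ be a (finite-rank, real, smooth) vector bundle over a smooth manifold $M$, and let $\mathcal M=T^*[3]E[1]$ be the shifted cotangent bundle of $E[1]$, with its canonical Poisson bracket $\{-,-\}$ of degree $-3$ on the functions that are polynomial in the momenta. In Darboux coordinates $(x,q,p,\xi)$ of degrees $(0,1,2,3)$, where $q$ is a fibre coordinate on $E[1]$ and $(\xi,p)$ are the momenta of $(x,q)$, the monomial $\xi^i p^j q^k$ has degree $3i+2j+k$ and bidegree $(2(i+j),i+k)$. Let $C^n$ be the space of functions of degree $n$ and $C^{a,b}\subseteq C^{a+b}$ the space of functions of bidegree $(a,b)$; thus $C^{0,k}=\Gamma\wedge^kE^*$ and $C^4=C^{4,0}\oplus C^{2,2}\oplus C^{0,4}$. A Q-structure is a function $\Theta\in C^4$ with $\{\Theta,\Theta\}=0$; it decomposes uniquely as $\Theta=\theta_2+\theta_{13}+\theta_4$ with $\theta_2\in C^{4,0}$, $\theta_{13}\in C^{2,2}$, $\theta_4\in C^{0,4}$. For $\phi\in C^{0,3}$ let $X_\phi=\{\phi,-\}$; the twisting of $\Theta$ by $\phi$ is $\Theta^\phi=\exp(X_\phi)(\Theta)=\sum_{i\ge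 0}\frac1{i!}X_\phi^i(\Theta)$. For $\theta_{13}\in C^{2,2}$ let $\delta=\{\theta_{13},-\}\colon C^{0,k}\to C^{0,k+1}$. Then: 1. For every Q-structure $\Theta=\theta_2+\theta_{13}+\theta_4$ and every $\phi\in C^{0,3}$ one has $X_\phi^i(\Theta)=0$ for $i\ge 3$, and $\Theta^\phi$ is again a Q-structure, with components $$\theta_2^\phi=\theta_2,\qquad \theta_{13}^\phi=\theta_{13}-\{\theta_2,\phi\},\qquad \theta_4^\phi=\theta_4-\{\theta_{13},\phi\}+\tfrac12\{\{\theta_2,\phi\},\phi\}.$$ Being a twisting of one another is an equivalence relation on the Q-structures. 2. For $\theta_{13}\in C^{2,2}$ and $\theta_4\in C^{0,4}$, the function $\theta_{13}+\theta_4$ is a Q-structure if and only if $\{\theta_{13},\theta_{13}\}=0$ and $\delta\theta_4=0$. In this case its twisting by $\phi\in C^{0,3}$ is $\theta_{13}+(\theta_4-\delta\phi)$. Hence two Q-structures $\theta_{13}+\theta_4$ and $\theta_{13}'+\theta_4'$ without $\theta_2$-part are equivalent under twisting if and only if $\theta_{13}=\theta_{13}'$ and $\theta_4-\theta_4'=\delta\phi$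 for some $\phi\in C^{0,3}$. 3. Let $\theta_{13}\in C^{2,2}$ satisfy $\{\theta_{13},\theta_{13}\}=0$. Then $\delta\circ\delta=0$ on $\Gamma\wedge^{\bullet}E^*$, and $\theta_{13}+\theta_4\mapsto[\theta_4]$ induces a bijection from the set of twisting classes of Q-structures with $\theta_2=0$ and with this $\theta_{13}$ onto the cohomology $H^4(\Gamma\wedge^{\bullet}E^*,\delta)$. -/

import Mathlib

open scoped Manifold ContDiff Topology
open Bundle

noncomputable section

/-! ### Functions on the shifted cotangent bundle `T*[3]N` of a graded manifold `N`

`A` is an ambient algebra and `𝒜 k ⊆ A` is the space of functions of degree `k` on a graded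
manifold `N`.  A function on `T*[3]N` that is polynomial in the momenta is the same thing as a family
of graded symmetric multiderivations of the functions on `N`: to `G` corresponds the family
`(a₁, …, aₘ) ↦ {…{{G, a₁}, a₂}, …, aₘ}` restricted to the zero section `N ⊆ T*[3]N`, whose value
on lists of length `m` records the part of `G` having exactly `m` momenta.  (If `a` is a function on
`N` and `(z, π)` are Darboux coordinates, with `z` on `N`, then `{z, π} = 1` and the momentum `π` is the
derivation `{π, a} = -∂a/∂z`.)  The canonical Poisson bracket of degree `-3` becomes the Schouten
bracket of multiderivations. -/

namespace ShiftedCotangent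

variable {A : Type*} [Ring A] [Algebra ℝ A]

/-- A homogeneous function on `N`, together with its degree. -/
abbrev Hom (𝒜 : ℤ → Submodule ℝ A) : Type _ := Σ k : ℤ, 𝒜 k

/-- Degree of `{…{G, a₁}, …, aₘ}` for `G` of degree `n`: every bracket has degree `-3`. -/
def deg {𝒜 : ℤ → Submodule ℝ A} : ℤ → List (Hom 𝒜) → ℤ
  | n, [] => n
  | n, a :: l => deg (n + a.1 - 3) l

theorem deg_congr {𝒜 : ℤ → Submodule ℝ A} {m n : ℤ} (h : m = n) {l : List (Hom 𝒜)} {x : A}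
    (hx : x ∈ 𝒜 (deg m l)) : x ∈ 𝒜 (deg n l) := h ▸ hx

/-- Graded multilinear families of total degree `n` (no symmetry or Leibniz rule imposed yet). -/
def multiSubmodule (𝒜 : ℤ → Submodule ℝ A) (n : ℤ) : Submodule ℝ (List (Hom 𝒜) → A) where
  carrier := {G | (∀ l, G l ∈ 𝒜 (deg n l)) ∧
    (∀ (l₁ l₂ : List (Hom 𝒜)) (k : ℤ) (a b : 𝒜 k),
      G (l₁ ++ ⟨k, a + b⟩ :: l₂) = G (l₁ ++ ⟨k, a⟩ :: l₂) + G (l₁ ++ ⟨k, b⟩ :: l₂)) ∧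
    (∀ (l₁ l₂ : List (Hom 𝒜)) (k : ℤ) (c : ℝ) (a : 𝒜 k),
      G (l₁ ++ ⟨k, c • a⟩ :: l₂) = c • G (l₁ ++ ⟨k, a⟩ :: l₂))}
  zero_mem' := ⟨fun _ => Submodule.zero_mem _, by simp, by simp⟩
  add_mem' := by
    rintro F G ⟨h1, h2, h3⟩ ⟨g1, g2, g3⟩
    refine ⟨fun l => Submodule.add_mem _ (h1 l) (g1 l), ?_, ?_⟩
    · intro l₁ l₂ k a b
      simp only [Pi.add_apply, h2, g2]
      abel
    · intro l₁ l₂ k c a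
      simp only [Pi.add_apply, h3, g3, smul_add]
  smul_mem' := by
    rintro c F ⟨h1, h2, h3⟩
    refine ⟨fun l => Submodule.smul_mem _ _ (h1 l), ?_, ?_⟩
    · intro l₁ l₂ k a b
      simp only [Pi.smul_apply, h2, smul_add]
    · intro l₁ l₂ k d a
      simp only [Pi.smul_apply, h3]
      rw [smul_comm]

/-- The vector space of graded multilinear families of total degree `n`. -/
def Multi (𝒜 : ℤ → Submodule ℝ A) (n : ℤ) : Type _ := multiSubmodule 𝒜 n

instance (𝒜 : ℤ → Submodule ℝ A) (n : ℤ) : AddCommGroup (Multi 𝒜 n) :=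
  inferInstanceAs (AddCommGroup (multiSubmodule 𝒜 n))

instance (𝒜 : ℤ → Submodule ℝ A) (n : ℤ) : Module ℝ (Multi 𝒜 n) :=
  inferInstanceAs (Module ℝ (multiSubmodule 𝒜 n))

variable {𝒜 : ℤ → Submodule ℝ A}

theorem Multi.zero_val (n : ℤ) (l : List (Hom 𝒜)) : (0 : Multi 𝒜 n).1 l = 0 := rfl

theorem Multi.add_val {n : ℤ} (F G : Multi 𝒜 n) (l : List (Hom 𝒜)) :
    (F + G).1 l = F.1 l + G.1 l := rfl

theorem Multi.smul_val {n : ℤ} (c : ℝ) (G : Multi 𝒜 n) (l : List (Hom 𝒜)) :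
    (c • G).1 l = c • G.1 l := rfl

/-- `{G, a}` for a homogeneous function `a` on `N`. -/
def contract {n : ℤ} (G : Multi 𝒜 n) (a : Hom 𝒜) : Multi 𝒜 (n + a.1 - 3) :=
  ⟨fun l => G.1 (a :: l), fun l => G.2.1 (a :: l), fun l₁ l₂ => G.2.2.1 (a :: l₁) l₂,
    fun l₁ l₂ => G.2.2.2 (a :: l₁) l₂⟩

/-- The restriction of `G` to the zero section, a function on `N`. -/
def base {n : ℤ} (G : Multi 𝒜 n) : 𝒜 n := ⟨G.1 [], G.2.1 []⟩

/-- The canonical Poisson bracket of degree `-3`.  The first clause is the restriction of `{F, G}` to the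
zero section; the second is
`{{F, G}, a} = {F, {G, a}} + (-1)^((|G| - 3) (|a| - 3)) {{F, a}, G}`. -/
def bracketFun : {f g : ℤ} → Multi 𝒜 f → Multi 𝒜 g → List (Hom 𝒜) → A
  | f, g, F, G, [] =>
      F.1 [⟨g, base G⟩] - ((f - 3) * (g - 3)).negOnePow • G.1 [⟨f, base F⟩]
  | _, g, F, G, a :: l =>
      bracketFun F (contract G a) l
        + ((g - 3) * (a.1 - 3)).negOnePow • bracketFun (contract F a) G l

theorem contract_add {n : ℤ} (F G : Multi 𝒜 n) (a : Hom 𝒜) :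
    contract (F + G) a = contract F a + contract G a := rfl

theorem contract_smul {n : ℤ} (c : ℝ) (G : Multi 𝒜 n) (a : Hom 𝒜) :
    contract (c • G) a = c • contract G a := rfl

theorem contract_arg_add {n : ℤ} (G : Multi 𝒜 n) (k : ℤ) (a b : 𝒜 k) :
    contract G ⟨k, a + b⟩ = contract G ⟨k, a⟩ + contract G ⟨k, b⟩ :=
  Subtype.ext (funext fun l => G.2.2.1 [] l k a b)

theorem contract_arg_smul {n : ℤ} (G : Multi 𝒜 n) (k : ℤ) (c : ℝ) (a : 𝒜 k) :
    contract G ⟨k, c • a⟩ = c • contract G ⟨k, a⟩ :=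
  Subtype.ext (funext fun l => G.2.2.2 [] l k c a)

theorem bracketFun_add_left (l : List (Hom 𝒜)) : ∀ {f g : ℤ} (F F' : Multi 𝒜 f) (G : Multi 𝒜 g),
    bracketFun (F + F') G l = bracketFun F G l + bracketFun F' G l := by
  induction l with
  | nil =>
    intro f g F F' G
    have h : G.1 [⟨f, base (F + F')⟩] = G.1 [⟨f, base F⟩] + G.1 [⟨f, base F'⟩] :=
      G.2.2.1 [] [] f (base F) (base F')
    have h' : (F + F').1 [⟨g, base G⟩] = F.1 [⟨g, base G⟩] + F'.1 [⟨g, base G⟩] := rfl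
    simp only [bracketFun, h, h', smul_add]
    abel
  | cons a l ih =>
    intro f g F F' G
    simp only [bracketFun, contract_add, ih, smul_add]
    abel

theorem bracketFun_add_right (l : List (Hom 𝒜)) : ∀ {f g : ℤ} (F : Multi 𝒜 f) (G G' : Multi 𝒜 g),
    bracketFun F (G + G') l = bracketFun F G l + bracketFun F G' l := by
  induction l with
  | nil =>
    intro f g F G G'
    have h : F.1 [⟨g, base (G + G')⟩] = F.1 [⟨g, base G⟩] + F.1 [⟨g, base G'⟩] :=
      F.2.2.1 [] [] g (base G) (base G')
    have h' : (G + G').1 [⟨f, base F⟩] = G.1 [⟨f, base F⟩] + G'.1 [⟨f, base F⟩] := rfl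
    simp only [bracketFun, h, h', smul_add]
    abel
  | cons a l ih =>
    intro f g F G G'
    simp only [bracketFun, contract_add, ih, smul_add]
    abel

theorem bracketFun_smul_left (l : List (Hom 𝒜)) : ∀ {f g : ℤ} (c : ℝ) (F : Multi 𝒜 f)
    (G : Multi 𝒜 g), bracketFun (c • F) G l = c • bracketFun F G l := by
  induction l with
  | nil =>
    intro f g c F G
    have h : G.1 [⟨f, base (c • F)⟩] = c • G.1 [⟨f, base F⟩] := G.2.2.2 [] [] f c (base F)
    have h' : (c • F).1 [⟨g, base G⟩] = c • F.1 [⟨g, base G⟩] := rfl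
    simp only [bracketFun, h, h', smul_sub]
    rw [smul_comm]
  | cons a l ih =>
    intro f g c F G
    simp only [bracketFun, contract_smul, ih, smul_add]
    rw [smul_comm]

theorem bracketFun_smul_right (l : List (Hom 𝒜)) : ∀ {f g : ℤ} (c : ℝ) (F : Multi 𝒜 f)
    (G : Multi 𝒜 g), bracketFun F (c • G) l = c • bracketFun F G l := by
  induction l with
  | nil =>
    intro f g c F G
    have h : F.1 [⟨g, base (c • G)⟩] = c • F.1 [⟨g, base G⟩] := F.2.2.2 [] [] g c (base G)
    have h' : (c • G).1 [⟨f, base F⟩] = c • G.1 [⟨f, base F⟩] := rfl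
    simp only [bracketFun, h, h', smul_sub]
    rw [smul_comm]
  | cons a l ih =>
    intro f g c F G
    simp only [bracketFun, contract_smul, ih, smul_add]
    rw [smul_comm]

theorem negOnePow_smul_mem {p : Submodule ℝ A} {x : A} (n : ℤ) (hx : x ∈ p) :
    n.negOnePow • x ∈ p := by
  rcases Int.even_or_odd n with h | h
  · simpa [Int.negOnePow_even n h] using hx
  · simpa [Int.negOnePow_odd n h] using hx

theorem bracketFun_deg (l : List (Hom 𝒜)) : ∀ {f g n : ℤ} (F : Multi 𝒜 f) (G : Multi 𝒜 g),
    n = f + g - 3 → bracketFun F G l ∈ 𝒜 (deg n l) := by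
  induction l with
  | nil =>
    intro f g n F G hn
    refine Submodule.sub_mem _ ?_ (negOnePow_smul_mem _ ?_)
    · exact deg_congr (l := []) hn.symm (F.2.1 [⟨g, base G⟩])
    · exact deg_congr (l := []) (by rw [hn]; ring : g + f - 3 = n) (G.2.1 [⟨f, base F⟩])
  | cons a l ih =>
    intro f g n F G hn
    refine Submodule.add_mem _ ?_ (negOnePow_smul_mem _ ?_)
    · exact ih F (contract G a) (by omega)
    · exact ih (contract F a) G (by omega)

theorem bracketFun_mem {f g n : ℤ} (hn : n = f + g - 3) (F : Multi 𝒜 f) (G : Multi 𝒜 g) :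
    bracketFun F G ∈ multiSubmodule 𝒜 n := by
  refine ⟨fun l => bracketFun_deg l F G hn, ?_, ?_⟩
  · intro l₁ l₂ k a b
    clear hn
    induction l₁ generalizing f g with
    | nil =>
      simp only [List.nil_append, bracketFun, contract_arg_add, bracketFun_add_left,
        bracketFun_add_right, smul_add]
      abel
    | cons c l₁ ih =>
      simp only [List.cons_append, bracketFun, ih, smul_add]
      abel
  · intro l₁ l₂ k c a
    clear hn
    induction l₁ generalizing f g with
    | nil =>
      simp only [List.nil_append, bracketFun, contract_arg_smul, bracketFun_smul_left,
        bracketFun_smul_right, smul_add]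
      rw [smul_comm]
    | cons b l₁ ih =>
      simp only [List.cons_append, bracketFun, ih, smul_add]
      rw [smul_comm]

/-- The Poisson bracket `{F, G}`, of degree `n = |F| + |G| - 3`. -/
def bracket {f g : ℤ} (n : ℤ) (hn : n = f + g - 3) :
    Multi 𝒜 f →ₗ[ℝ] Multi 𝒜 g →ₗ[ℝ] Multi 𝒜 n :=
  LinearMap.mk₂ ℝ (fun F G => ⟨bracketFun F G, bracketFun_mem hn F G⟩)
    (fun F F' G => Subtype.ext (funext fun l => bracketFun_add_left l F F' G))
    (fun c F G => Subtype.ext (funext fun l => bracketFun_smul_left l c F G))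
    (fun F G G' => Subtype.ext (funext fun l => bracketFun_add_right l F G G'))
    (fun c F G => Subtype.ext (funext fun l => bracketFun_smul_right l c F G))

variable (𝒜)

/-- `C^n(T*[3]N)`: functions of degree `n`.  They are the families which are graded symmetric,
satisfy the graded Leibniz rule `{G, ab} = {G, a} b + (-1)^((|G| - 3) |a|) a {G, b}`,
and (as `n = 2m + j` with `j ≥ 0` for a function of bidegree `(2m, j)`) have at most `n / 2` momenta. -/
def C [SetLike.GradedMul 𝒜] (n : ℕ) : Submodule ℝ (Multi 𝒜 n) where
  carrier := {G |
    (∀ (l₁ l₂ : List (Hom 𝒜)) (a b : Hom 𝒜),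
      G.1 (l₁ ++ a :: b :: l₂) = ((a.1 - 3) * (b.1 - 3)).negOnePow • G.1 (l₁ ++ b :: a :: l₂)) ∧
    (∀ (l : List (Hom 𝒜)) (j k : ℤ) (a : 𝒜 j) (b : 𝒜 k),
      G.1 (l ++ [⟨j + k, ⟨(a : A) * b, SetLike.mul_mem_graded a.2 b.2⟩⟩])
        = G.1 (l ++ [⟨j, a⟩]) * b
          + ((deg n l - 3) * j).negOnePow • ((a : A) * G.1 (l ++ [⟨k, b⟩]))) ∧
    (∀ l : List (Hom 𝒜), n < 2 * l.length → G.1 l = 0)}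
  zero_mem' := by
    refine ⟨?_, ?_, ?_⟩ <;> simp [Multi.zero_val]
  add_mem' := by
    rintro F G ⟨h1, h2, h3⟩ ⟨g1, g2, g3⟩
    refine ⟨?_, ?_, ?_⟩
    · intro l₁ l₂ a b
      simp only [Multi.add_val]
      rw [h1, g1, smul_add]
    · intro l j k a b
      simp only [Multi.add_val]
      rw [h2, g2, add_mul, mul_add, smul_add]
      abel
    · intro l hl
      simp [Multi.add_val, h3 l hl, g3 l hl]
  smul_mem' := by
    rintro c F ⟨h1, h2, h3⟩
    refine ⟨?_, ?_, ?_⟩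
    · intro l₁ l₂ a b
      simp only [Multi.smul_val]
      rw [h1, smul_comm]
    · intro l j k a b
      simp only [Multi.smul_val]
      rw [h2, smul_add, smul_comm c, smul_mul_assoc, mul_smul_comm]
    · intro l hl
      simp [Multi.smul_val, h3 l hl]

/-- `C^{p,q}(T*[3]N) ⊆ C^n(T*[3]N)` with `n = p + q`: functions of bidegree `(p, q)`, that is, with exactly
`p / 2` momenta. -/
def BiC [SetLike.GradedMul 𝒜] (n p q : ℕ) : Submodule ℝ (Multi 𝒜 n) where
  carrier := {G | G ∈ C 𝒜 n ∧ ∀ l : List (Hom 𝒜), ¬ (2 * l.length = p ∧ p + q = n) → G.1 l = 0}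
  zero_mem' := ⟨Submodule.zero_mem _, by simp [Multi.zero_val]⟩
  add_mem' := by
    rintro F G ⟨h1, h2⟩ ⟨g1, g2⟩
    exact ⟨Submodule.add_mem _ h1 g1, fun l hl => by simp [Multi.add_val, h2 l hl, g2 l hl]⟩
  smul_mem' := by
    rintro c F ⟨h1, h2⟩
    exact ⟨Submodule.smul_mem _ _ h1, fun l hl => by simp [Multi.smul_val, h2 l hl]⟩

/-- Q-structures: functions of degree `4` that solve the classical master equation `{Θ, Θ} = 0`. -/
def IsQStructure [SetLike.GradedMul 𝒜] (Θ : Multi 𝒜 (4 : ℕ)) : Prop :=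
  Θ ∈ C 𝒜 4 ∧ bracket 5 (by norm_num) Θ Θ = 0

/-- The type of Q-structures. -/
abbrev QStructure [SetLike.GradedMul 𝒜] : Type _ := {Θ : Multi 𝒜 (4 : ℕ) // IsQStructure 𝒜 Θ}

variable {𝒜}

/-- The Hamiltonian vector field `X_φ = {φ, -}` of a function `φ` of degree `3`, acting on degree `n`. -/
def X (φ : Multi 𝒜 (3 : ℕ)) (n : ℤ) : Multi 𝒜 n →ₗ[ℝ] Multi 𝒜 n :=
  bracket n (by norm_num) φ

/-- `exp(X_φ)(G) = ∑ᵢ X_φⁱ(G) / i!` (a finite sum whenever only finitely many terms are nonzero). -/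
def expX (φ : Multi 𝒜 (3 : ℕ)) {n : ℤ} (G : Multi 𝒜 n) : Multi 𝒜 n :=
  ∑ᶠ i : ℕ, ((i.factorial : ℝ)⁻¹) • (X φ n ^ i) G

/-- `Θ'` is a twisting of `Θ` by some `φ ∈ C^{0,3}`. -/
def Twist [SetLike.GradedMul 𝒜] (Θ Θ' : QStructure 𝒜) : Prop :=
  ∃ φ ∈ BiC 𝒜 3 0 3, Θ'.1 = expX φ Θ.1

/-- The space `C^{0,k} = C^k(N)` of functions of degree `k` on `N`, as a space of functions on
`T*[3]N`. -/
abbrev Cochain (𝒜 : ℤ → Submodule ℝ A) [SetLike.GradedMul 𝒜] (k : ℕ) : Submodule ℝ (Multi 𝒜 k) :=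
  BiC 𝒜 k 0 k

theorem bracketFun_zero_right (l : List (Hom 𝒜)) {f g : ℤ} (F : Multi 𝒜 f) :
    bracketFun F (0 : Multi 𝒜 g) l = 0 := by
  simpa using bracketFun_smul_right l (0 : ℝ) F (0 : Multi 𝒜 g)

theorem bracketFun_zero_left (l : List (Hom 𝒜)) {f g : ℤ} (G : Multi 𝒜 g) :
    bracketFun (0 : Multi 𝒜 f) G l = 0 := by
  simpa using bracketFun_smul_left l (0 : ℝ) (0 : Multi 𝒜 f) G

theorem bracketFun_base (l : List (Hom 𝒜)) {f g : ℤ} (F : Multi 𝒜 f) (G : Multi 𝒜 g)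
    (hF : ∀ l, l ≠ [] → F.1 l = 0) (hG : ∀ l, l ≠ [] → G.1 l = 0) : bracketFun F G l = 0 := by
  cases l with
  | nil => simp [bracketFun, hF, hG]
  | cons a l =>
    have h1 : contract F a = 0 := Subtype.ext (funext fun l => hF (a :: l) (by simp))
    have h2 : contract G a = 0 := Subtype.ext (funext fun l => hG (a :: l) (by simp))
    simp [bracketFun, h1, h2, bracketFun_zero_left, bracketFun_zero_right]

theorem bracket_mem_cochain [SetLike.GradedMul 𝒜] {θ : Multi 𝒜 (4 : ℕ)} (hθ : θ ∈ BiC 𝒜 4 2 2)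
    {k : ℕ} {α : Multi 𝒜 k} (hα : α ∈ Cochain 𝒜 k) :
    bracket ((k + 1 : ℕ) : ℤ) (by push_cast; ring) θ α ∈ Cochain 𝒜 (k + 1) := by
  have hα' : ∀ l : List (Hom 𝒜), l ≠ [] → α.1 l = 0 := fun l hl =>
    hα.2 l (by simp [hl])
  have key : ∀ l : List (Hom 𝒜), l ≠ [] → bracketFun θ α l = 0 := by
    intro l hl
    cases l with
    | nil => exact absurd rfl hl
    | cons a l =>
      have h2 : contract α a = 0 := Subtype.ext (funext fun l => hα' (a :: l) (by simp))
      have h3 : bracketFun (contract θ a) α l = 0 := by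
        refine bracketFun_base l _ _ (fun l hl => hθ.2 (a :: l) ?_) hα'
        have := List.length_pos_iff.2 hl
        simp only [List.length_cons]
        omega
      simp [bracketFun, h2, h3, bracketFun_zero_right]
  refine ⟨⟨?_, ?_, ?_⟩, ?_⟩
  · intro l₁ l₂ a b
    change bracketFun θ α _ = _ • bracketFun θ α _
    rw [key _ (by simp), key _ (by simp), smul_zero]
  · intro l j m a b
    change bracketFun θ α _ = bracketFun θ α _ * _ + _ • (_ * bracketFun θ α _)
    rw [key _ (by simp), key _ (by simp), key _ (by simp)]
    simp
  · intro l hl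
    exact key l (by rintro rfl; simp at hl)
  · intro l hl
    exact key l (by rintro rfl; simp at hl)

/-- `δ = {θ₁₃, -} : C^{0,k} → C^{0,k+1}` for `θ₁₃ ∈ C^{2,2}`. -/
def δ [SetLike.GradedMul 𝒜] (θ : BiC 𝒜 4 2 2) (k : ℕ) :
    Cochain 𝒜 k →ₗ[ℝ] Cochain 𝒜 (k + 1) :=
  ((bracket ((k + 1 : ℕ) : ℤ) (by push_cast; ring) θ.1).comp (Cochain 𝒜 k).subtype).codRestrict _
    fun α => bracket_mem_cochain θ.2 α.2

/-- The cohomology in degree `k + 1` of `(C^{0,•}, δ)`: cocycles modulo coboundaries. -/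
abbrev H [SetLike.GradedMul 𝒜] (θ : BiC 𝒜 4 2 2) (k : ℕ) : Type _ :=
  LinearMap.ker (δ θ (k + 1)) ⧸ (LinearMap.range (δ θ k)).submoduleOf (LinearMap.ker (δ θ (k + 1)))

/-- The Q-structures `Θ = θ₁₃ + θ₄` without `θ₂`-part, with prescribed `(2,2)`-part `θ₁₃`. -/
abbrev QStructureOver [SetLike.GradedMul 𝒜] (θ : BiC 𝒜 4 2 2) : Type _ :=
  {Θ : QStructure 𝒜 // ∃ θ₄ : BiC 𝒜 4 0 4, Θ.1 = θ.1 + θ₄.1}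

end ShiftedCotangent

/-! ### The functions on `E[1]`: smooth sections of the exterior algebra bundle `∧E*` -/

section Forms

variable (d : ℕ) {M : Type*} [TopologicalSpace M] [ChartedSpace (EuclideanSpace ℝ (Fin d)) M]
  (F : Type*) [NormedAddCommGroup F] [NormedSpace ℝ F]
  (E : M → Type*) [∀ x, AddCommGroup (E x)] [∀ x, Module ℝ (E x)]
  [∀ x, TopologicalSpace (E x)] [TopologicalSpace (TotalSpace F E)] [FiberBundle F E]

/-- All (not necessarily smooth) sections of `∧E*`. -/
abbrev RawForm {M : Type*} (E : M → Type*) [∀ x, AddCommGroup (E x)] [∀ x, Module ℝ (E x)] : Type _ :=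
  ∀ x, ExteriorAlgebra ℝ (Module.Dual ℝ (E x))

/-- A section of `E*` is smooth if its pairing with every smooth section of `E` is smooth. -/
def IsSmoothCovector (α : ∀ x, Module.Dual ℝ (E x)) : Prop :=
  ∀ e : Cₛ^∞⟮𝓡 d; F, E⟯, ContMDiff (𝓡 d) 𝓘(ℝ, ℝ) ∞ fun x => α x (e x)

/-- The algebra generated by the smooth functions on `M` and the smooth sections of `E*`. -/
def generatedForms : Subalgebra ℝ (RawForm E) :=
  Algebra.adjoin ℝ
    ({s | ∃ f : M → ℝ, ContMDiff (𝓡 d) 𝓘(ℝ, ℝ) ∞ f ∧ s = fun x => algebraMap ℝ _ (f x)} ∪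
      {s | ∃ α : ∀ x, Module.Dual ℝ (E x), IsSmoothCovector d F E α ∧
        s = fun x => ExteriorAlgebra.ι ℝ (α x)})

/-- The algebra of smooth sections of `∧E*`: a section is smooth if around every point it is a sum of products
of smooth functions and smooth sections of `E*`. -/
def smoothForms : Subalgebra ℝ (RawForm E) where
  carrier := {s | ∀ x₀ : M, ∃ t ∈ generatedForms d F E, ∀ᶠ x in 𝓝 x₀, s x = t x}
  mul_mem' := by
    intro s s' hs hs' x₀
    obtain ⟨t, ht, h⟩ := hs x₀
    obtain ⟨t', ht', h'⟩ := hs' x₀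
    refine ⟨t * t', mul_mem ht ht', ?_⟩
    filter_upwards [h, h'] with x hx hx'
    simp [hx, hx']
  add_mem' := by
    intro s s' hs hs' x₀
    obtain ⟨t, ht, h⟩ := hs x₀
    obtain ⟨t', ht', h'⟩ := hs' x₀
    refine ⟨t + t', add_mem ht ht', ?_⟩
    filter_upwards [h, h'] with x hx hx'
    simp [hx, hx']
  algebraMap_mem' := fun r x₀ =>
    ⟨algebraMap ℝ _ r, Subalgebra.algebraMap_mem _ r, Filter.Eventually.of_forall fun _ => rfl⟩

/-- `Γ∧^k E*`, the functions of degree `k` on `E[1]`; zero for `k < 0`. -/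
def Forms (k : ℤ) : Submodule ℝ (RawForm E) where
  carrier := {s | s ∈ smoothForms d F E ∧ (k < 0 → s = 0) ∧
    ∀ x, s x ∈ ⋀[ℝ]^k.toNat (Module.Dual ℝ (E x))}
  zero_mem' := ⟨zero_mem _, fun _ => rfl, fun _ => Submodule.zero_mem _⟩
  add_mem' := by
    rintro s t ⟨h1, h2, h3⟩ ⟨g1, g2, g3⟩
    exact ⟨add_mem h1 g1, fun hk => by simp [h2 hk, g2 hk],
      fun x => Submodule.add_mem _ (h3 x) (g3 x)⟩
  smul_mem' := by
    rintro c s ⟨h1, h2, h3⟩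
    exact ⟨Subalgebra.smul_mem _ h1 c, fun hk => by simp [h2 hk],
      fun x => Submodule.smul_mem _ _ (h3 x)⟩

instance Forms.gradedMul : SetLike.GradedMul (Forms d F E) where
  mul_mem := by
    rintro j k s t ⟨h1, h2, h3⟩ ⟨g1, g2, g3⟩
    have hzero : j < 0 ∨ k < 0 → s * t = 0 := by
      rintro (h | h)
      · rw [h2 h, zero_mul]
      · rw [g2 h, mul_zero]
    refine ⟨mul_mem h1 g1, fun h => hzero (by omega), fun x => ?_⟩
    by_cases h : j < 0 ∨ k < 0
    · rw [hzero h]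
      exact Submodule.zero_mem _
    · have e : (j + k).toNat = j.toNat + k.toNat := by omega
      rw [e]
      exact SetLike.mul_mem_graded (A := fun i : ℕ => ⋀[ℝ]^i (Module.Dual ℝ (E x))) (h3 x) (g3 x)

end Forms

end

noncomputable section

namespace ShiftedCotangent

section Bracket

variable {A : Type*} [Ring A] [Algebra ℝ A] {𝒜 : ℤ → Submodule ℝ A}

/-! ### Graded antisymmetry and the Jacobi identity -/

/-! A function with momenta is known from its values on lists of functions on the base. The bracket
is defined by recursion on such lists, so contraction with a function is a graded derivation of it
by construction. Induction on the list therefore reduces `bracketFun_jacobi` to the restriction to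
the zero section, where graded symmetry of the families is all that is needed. Counting momenta is
counting list entries.

A function `φ` of bidegree `(0, 3)` has no momenta, and its shifted degree `3 - 3` is zero. Hence `X
φ` is, up to a global sign, insertion of `φ` as an argument (`X_val`). Such insertions commute with
one another, each removes one momentum, and any three of them kill `C⁴`. So `exp(X_φ)` is a
quadratic polynomial in `X_φ`, `φ ↦ exp(X_φ)` is additive-to-multiplicative on `C⁴`, and sorting by
momenta gives the components of a twisting. By the Jacobi identity `X_φ` is a derivation of the
bracket, so its exponential preserves the master equation (`IsQStructure.expX`).

Without a `θ₂`-part, `{Θ, Θ}` is `{θ₁₃, θ₁₃}` (one momentum) plus `2 {θ₁₃, θ₄}` (none), so the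
master equation splits into two. Twisting then shifts the cocycle `θ₄` by the coboundary `-δφ`,
which identifies twisting classes with `H⁴`. -/

/-- Graded symmetry of a multilinear family. -/
def GradedSymm {n : ℤ} (G : Multi 𝒜 n) : Prop :=
  ∀ (l₁ l₂ : List (Hom 𝒜)) (a b : Hom 𝒜),
    G.1 (l₁ ++ a :: b :: l₂) = ((a.1 - 3) * (b.1 - 3)).negOnePow • G.1 (l₁ ++ b :: a :: l₂)

theorem GradedSymm.contract {n : ℤ} {G : Multi 𝒜 n} (hG : GradedSymm G) (a : Hom 𝒜) :
    GradedSymm (contract G a) :=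
  fun l₁ l₂ b c => hG (a :: l₁) l₂ b c

theorem Hom.ext_val {j k : ℤ} (h : j = k) {x : 𝒜 j} {y : 𝒜 k} (hxy : (x : A) = y) :
    (⟨j, x⟩ : Hom 𝒜) = ⟨k, y⟩ := by
  subst h
  rw [Subtype.ext hxy]

theorem Multi.ext {n : ℤ} {F G : Multi 𝒜 n} (h : ∀ l, F.1 l = G.1 l) : F = G :=
  Subtype.ext (funext h)

theorem Multi.neg_val {n : ℤ} (G : Multi 𝒜 n) (l : List (Hom 𝒜)) : (-G).1 l = -G.1 l := rfl

theorem bracket_val {f g n : ℤ} (hn : n = f + g - 3) (F : Multi 𝒜 f) (G : Multi 𝒜 g)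
    (l : List (Hom 𝒜)) : (bracket n hn F G).1 l = bracketFun F G l := rfl

theorem bracketFun_swap (l : List (Hom 𝒜)) : ∀ {f g : ℤ} (F : Multi 𝒜 f) (G : Multi 𝒜 g),
    bracketFun F G l = -(((f - 3) * (g - 3)).negOnePow • bracketFun G F l) := by
  induction l with
  | nil =>
    intro f g F G
    simp only [bracketFun, mul_comm (g - 3)]
    rcases Int.units_eq_one_or ((f - 3) * (g - 3)).negOnePow with h | h <;> simp [h]
  | cons a l ih =>
    intro f g F G
    simp only [bracketFun]
    rw [ih F (contract G a), ih (contract F a) G,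
      show (f - 3) * (g + a.1 - 3 - 3) = (f - 3) * (g - 3) + (f - 3) * (a.1 - 3) by ring,
      show (f + a.1 - 3 - 3) * (g - 3) = (f - 3) * (g - 3) + (g - 3) * (a.1 - 3) by ring,
      Int.negOnePow_add, Int.negOnePow_add]
    rcases Int.units_eq_one_or ((f - 3) * (g - 3)).negOnePow with h₁ | h₁ <;>
    rcases Int.units_eq_one_or ((f - 3) * (a.1 - 3)).negOnePow with h₂ | h₂ <;>
    rcases Int.units_eq_one_or ((g - 3) * (a.1 - 3)).negOnePow with h₃ | h₃ <;>
    simp [h₁, h₂, h₃, add_comm]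

theorem bracketFun_neg_left (l : List (Hom 𝒜)) {f g : ℤ} (F : Multi 𝒜 f) (G : Multi 𝒜 g) :
    bracketFun (-F) G l = -bracketFun F G l := by
  simpa using bracketFun_smul_left l (-1) F G

theorem bracketFun_neg_right (l : List (Hom 𝒜)) {f g : ℤ} (F : Multi 𝒜 f) (G : Multi 𝒜 g) :
    bracketFun F (-G) l = -bracketFun F G l := by
  simpa using bracketFun_smul_right l (-1) F G

theorem contract_bracket {f g n : ℤ} (hn : n = f + g - 3) (F : Multi 𝒜 f) (G : Multi 𝒜 g)
    (a : Hom 𝒜) :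
    contract (bracket n hn F G) a =
      bracket (n + a.1 - 3) (by omega) F (contract G a)
        + (((g - 3) * (a.1 - 3)).negOnePow : ℤ) •
            bracket (n + a.1 - 3) (by omega) (contract F a) G := by
  rfl

/-- Value of a family on the restriction of a bracket to the zero section. -/
theorem val_base_bracket {f g h n : ℤ} (hn : n = f + g - 3) (F : Multi 𝒜 f) (G : Multi 𝒜 g)
    (K : Multi 𝒜 h) :
    K.1 [⟨n, base (bracket n hn F G)⟩] =
      K.1 [⟨_, base (contract F ⟨g, base G⟩)⟩]
        - ((f - 3) * (g - 3)).negOnePow • K.1 [⟨_, base (contract G ⟨f, base F⟩)⟩] := by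
  subst hn
  -- The two terms of the bracket lie in degrees `f + g - 3` and `g + f - 3`, which are only
  -- propositionally equal, so the second is re-typed.
  have pf : (base (contract G ⟨f, base F⟩) : A) ∈ 𝒜 (f + g - 3) := by
    rw [show f + g - 3 = g + f - 3 by ring]
    exact (base (contract G ⟨f, base F⟩)).2
  have e : (⟨g + f - 3, base (contract G ⟨f, base F⟩)⟩ : Hom 𝒜) =
      ⟨f + g - 3, ⟨(base (contract G ⟨f, base F⟩) : A), pf⟩⟩ := Hom.ext_val (by ring) rfl
  rw [e]
  -- The unit sign becomes a real scalar so that the `ℝ`-linearity of `K` applies.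
  have hs : ∃ c : ℝ, ∀ x : A, ((f - 3) * (g - 3)).negOnePow • x = c • x := by
    rcases Int.units_eq_one_or ((f - 3) * (g - 3)).negOnePow with h | h
    · exact ⟨1, by simp [h]⟩
    · exact ⟨-1, by simp [h]⟩
  obtain ⟨c, hc⟩ := hs
  have e₂ : base (bracket (f + g - 3) rfl F G) = base (contract F ⟨g, base G⟩)
      + (-c) • (⟨(base (contract G ⟨f, base F⟩) : A), pf⟩ : 𝒜 (f + g - 3)) := by
    apply Subtype.ext
    change F.1 [⟨g, base G⟩] - ((f - 3) * (g - 3)).negOnePow • G.1 [⟨f, base F⟩] =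
      F.1 [⟨g, base G⟩] + (-c) • G.1 [⟨f, base F⟩]
    rw [hc, neg_smul, sub_eq_add_neg]
  rw [e₂, hc]
  refine ((K.2.2.1 [] [] _ _ _).trans (congrArg _ (K.2.2.2 [] [] _ _ _))).trans ?_
  exact (congrArg _ (neg_smul _ _)).trans (sub_eq_add_neg _ _).symm

/-- Contraction is a derivation, so contracting the identity for `(F, G, H)` gives the identities
for the triples with one entry contracted. The degrees `p`, `q`, `r` are free variables with
equations because contraction changes them to expressions that agree only propositionally. -/
theorem bracketFun_jacobi (l : List (Hom 𝒜)) : ∀ {f g h p q r : ℤ} (hp : p = f + g - 3)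
    (hq : q = g + h - 3) (hr : r = f + h - 3) {F : Multi 𝒜 f} {G : Multi 𝒜 g} {H : Multi 𝒜 h},
    GradedSymm F → GradedSymm G → GradedSymm H →
    bracketFun F (bracket q hq G H) l = bracketFun (bracket p hp F G) H l
      + ((f - 3) * (g - 3)).negOnePow • bracketFun G (bracket r hr F H) l := by
  induction l with
  | nil =>
    intro f g h p q r hp hq hr F G H hF hG hH
    simp only [bracketFun, val_base_bracket, bracket_val]
    -- The iterated first-order terms cancel directly. What remains are values of each of `F`, `G`,
    -- `H` on the two other base functions in both orders, and these match by graded symmetry. The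
    -- rest is parity of signs.
    have sF := hF [] [] ⟨g, base G⟩ ⟨h, base H⟩
    have sG := hG [] [] ⟨f, base F⟩ ⟨h, base H⟩
    have sH := hH [] [] ⟨f, base F⟩ ⟨g, base G⟩
    simp only [List.nil_append] at sF sG sH
    simp only [contract]
    rw [sF, sG, sH]
    rw [show (f - 3) * (q - 3) = (f - 3) * (g - 3) + (f - 3) * (h - 3) by subst hq; ring,
      show (p - 3) * (h - 3) = (f - 3) * (h - 3) + (g - 3) * (h - 3) by subst hp; ring,
      show (g - 3) * (r - 3) = (f - 3) * (g - 3) + (g - 3) * (h - 3) by subst hr; ring,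
      show (g - 3) * (h + f - 3 - 3) = (f - 3) * (g - 3) + (g - 3) * (h - 3) by ring,
      show (g + f - 3 - 3) * (h - 3) = (f - 3) * (h - 3) + (g - 3) * (h - 3) by ring,
      show (f - 3) * (g + h - 3 - 3) = (f - 3) * (g - 3) + (f - 3) * (h - 3) by ring,
      show (f + h - 3 - 3) * (g - 3) = (f - 3) * (g - 3) + (g - 3) * (h - 3) by ring,
      show (f - 3) * (h + g - 3 - 3) = (f - 3) * (g - 3) + (f - 3) * (h - 3) by ring,
      show (f + g - 3 - 3) * (h - 3) = (f - 3) * (h - 3) + (g - 3) * (h - 3) by ring,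
      show (h - 3) * (f - 3) = (f - 3) * (h - 3) by ring,
      show (h - 3) * (g - 3) = (g - 3) * (h - 3) by ring]
    simp only [Int.negOnePow_add]
    rcases Int.units_eq_one_or ((f - 3) * (g - 3)).negOnePow with h₁ | h₁ <;>
    rcases Int.units_eq_one_or ((f - 3) * (h - 3)).negOnePow with h₂ | h₂ <;>
    rcases Int.units_eq_one_or ((g - 3) * (h - 3)).negOnePow with h₃ | h₃ <;>
    simp [h₁, h₂, h₃] <;> abel
  | cons a l ih =>
    intro f g h p q r hp hq hr F G H hF hG hH
    have key : ∀ {i j k m : ℤ} (hm : m = i + j - 3) (I : Multi 𝒜 i) (J : Multi 𝒜 j)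
        (K : Multi 𝒜 k),
        bracketFun K (contract (bracket m hm I J) a) l =
          bracketFun K (bracket (m + a.1 - 3) (by omega) I (contract J a)) l
          + ((j - 3) * (a.1 - 3)).negOnePow •
            bracketFun K (bracket (m + a.1 - 3) (by omega) (contract I a) J) l ∧
        bracketFun (contract (bracket m hm I J) a) K l =
          bracketFun (bracket (m + a.1 - 3) (by omega) I (contract J a)) K l
          + ((j - 3) * (a.1 - 3)).negOnePow •
            bracketFun (bracket (m + a.1 - 3) (by omega) (contract I a) J) K l := by
      intro i j k m hm I J K
      rw [contract_bracket, bracketFun_add_right, bracketFun_add_left]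
      rcases Int.units_eq_one_or ((j - 3) * (a.1 - 3)).negOnePow with h | h
      · simp [h]
      · simp [h, bracketFun_neg_left, bracketFun_neg_right]
    simp only [bracketFun]
    rw [(key hq G H F).1, (key hp F G H).2, (key hr F H G).1,
      ih hp (by omega) (by omega) hF hG (hH.contract a) (q := q + a.1 - 3) (r := r + a.1 - 3),
      ih (by omega) (by omega) hr hF (hG.contract a) hH (q := q + a.1 - 3) (p := p + a.1 - 3),
      ih (by omega) hq (by omega) (hF.contract a) hG hH (p := p + a.1 - 3) (r := r + a.1 - 3)]
    rw [show (q - 3) * (a.1 - 3) = (g - 3) * (a.1 - 3) + (h - 3) * (a.1 - 3) by subst hq; ring,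
      show (r - 3) * (a.1 - 3) = (f - 3) * (a.1 - 3) + (h - 3) * (a.1 - 3) by subst hr; ring,
      show (f - 3) * (g + a.1 - 3 - 3) = (f - 3) * (g - 3) + (f - 3) * (a.1 - 3) by ring,
      show (f + a.1 - 3 - 3) * (g - 3) = (f - 3) * (g - 3) + (g - 3) * (a.1 - 3) by ring]
    simp only [Int.negOnePow_add]
    rcases Int.units_eq_one_or ((f - 3) * (g - 3)).negOnePow with h₁ | h₁ <;>
    rcases Int.units_eq_one_or ((f - 3) * (a.1 - 3)).negOnePow with h₂ | h₂ <;>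
    rcases Int.units_eq_one_or ((g - 3) * (a.1 - 3)).negOnePow with h₃ | h₃ <;>
    rcases Int.units_eq_one_or ((h - 3) * (a.1 - 3)).negOnePow with h₄ | h₄ <;>
    simp [h₁, h₂, h₃, h₄] <;> abel

/-- The bracket of families with `p` and `q` momenta has `p + q - 1` momenta. -/
theorem bracketFun_eq_zero_of_length (l : List (Hom 𝒜)) : ∀ {f g : ℤ} {p q : ℕ} {F : Multi 𝒜 f}
    {G : Multi 𝒜 g}, (∀ l, l.length ≠ p → F.1 l = 0) → (∀ l, l.length ≠ q → G.1 l = 0) →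
    l.length + 1 ≠ p + q → bracketFun F G l = 0 := by
  have hz {n k : ℤ} (G : Multi 𝒜 n) (a : 𝒜 k) (ha : a = 0) : G.1 [⟨k, a⟩] = 0 := by
    subst ha
    simpa using G.2.2.2 [] [] k 0 0
  have hc {n : ℤ} {p : ℕ} {F : Multi 𝒜 n} (hF : ∀ l, l.length ≠ p → F.1 l = 0) (a : Hom 𝒜) :
      (p = 0 ∧ contract F a = 0) ∨ ∃ p', p = p' + 1 ∧
        ∀ l, l.length ≠ p' → (contract F a).1 l = 0 := by
    cases p with
    | zero => exact .inl ⟨rfl, Multi.ext fun l => hF (a :: l) (by simp)⟩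
    | succ p' => exact .inr ⟨p', rfl, fun l hl => hF (a :: l) (by simpa using hl)⟩
  induction l with
  | nil =>
    intro f g p q F G hF hG hl
    -- This term can survive only for `q = 0` and `p = 1`, which the length condition excludes.
    have h₁ : F.1 [⟨g, base G⟩] = 0 := by
      by_cases hq : q = 0
      · exact hF _ (by simp at hl ⊢; omega)
      · exact hz F _ (Subtype.ext (hG [] (by simpa using Ne.symm hq)))
    have h₂ : G.1 [⟨f, base F⟩] = 0 := by
      by_cases hp : p = 0
      · exact hG _ (by simp at hl ⊢; omega)
      · exact hz G _ (Subtype.ext (hF [] (by simpa using Ne.symm hp)))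
    simp [bracketFun, h₁, h₂]
  | cons a l ih =>
    intro f g p q F G hF hG hl
    simp only [List.length_cons] at hl
    have h₁ : bracketFun F (contract G a) l = 0 := by
      rcases hc hG a with ⟨-, h⟩ | ⟨q', rfl, h⟩
      · rw [h, bracketFun_zero_right]
      · exact ih hF h (by omega)
    have h₂ : bracketFun (contract F a) G l = 0 := by
      rcases hc hF a with ⟨-, h⟩ | ⟨p', rfl, h⟩
      · rw [h, bracketFun_zero_left]
      · exact ih h hG (by omega)
    simp [bracketFun, h₁, h₂]

end Bracket

section Hamiltonian

variable {A : Type*} [Ring A] [Algebra ℝ A] {𝒜 : ℤ → Submodule ℝ A}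

/-! ### The Hamiltonian vector field of a function of bidegree `(0, 3)` -/

/-- An argument of degree 3 has shifted degree zero, so it moves past every other argument without a
sign. -/
theorem GradedSymm.val_append {n : ℤ} {G : Multi 𝒜 n} (hG : GradedSymm G) (a : Hom 𝒜)
    (ha : a.1 = 3) (l : List (Hom 𝒜)) : G.1 (l ++ [a]) = G.1 (a :: l) := by
  induction l generalizing n G with
  | nil => rfl
  | cons b l ih =>
    have h₁ : G.1 (b :: l ++ [a]) = G.1 (b :: a :: l) := ih (hG.contract b)
    have h₂ : G.1 (b :: a :: l) = _ := hG [] l b a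
    rw [h₁, h₂, ha]
    simp

/-- Contractions of `φ` vanish, so the recursion contracts only `G` and inserts `φ` at the very end
of the list. -/
theorem bracketFun_cochain {φ : Multi 𝒜 (3 : ℕ)} (hφ : ∀ l, l ≠ [] → φ.1 l = 0)
    (l : List (Hom 𝒜)) {n : ℤ} (G : Multi 𝒜 n) :
    bracketFun G φ l = G.1 (l ++ [⟨_, base φ⟩]) := by
  induction l generalizing n G with
  | nil => simp [bracketFun, hφ]
  | cons a l ih =>
    have h : contract φ a = 0 := Multi.ext fun l => hφ (a :: l) (by simp)
    simp only [bracketFun, h, bracketFun_zero_right, ih]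
    simp [contract]

theorem X_add (φ ψ : Multi 𝒜 (3 : ℕ)) (n : ℤ) : X (φ + ψ) n = X φ n + X ψ n := by
  simp only [X, map_add]

/-- In degree 4 the shifted degree is odd, so graded antisymmetry is symmetry. -/
theorem bracket_four_comm (F G : Multi 𝒜 (4 : ℕ)) :
    bracket 5 (by norm_num) F G = bracket 5 (by norm_num) G F :=
  Multi.ext fun l => by
    rw [bracket_val, bracket_val, bracketFun_swap]
    norm_num

theorem bracket_cochain {φ : Multi 𝒜 (3 : ℕ)} (G : Multi 𝒜 (4 : ℕ)) :
    bracket (4 : ℕ) (by norm_num) G φ = -X φ _ G :=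
  Multi.ext fun l => by
    rw [bracket_val, bracketFun_swap]
    simp [X, Multi.neg_val, bracket_val]

variable [SetLike.GradedMul 𝒜]

theorem cochain_val {k : ℕ} {φ : Multi 𝒜 k} (hφ : φ ∈ Cochain 𝒜 k) (l : List (Hom 𝒜))
    (hl : l ≠ []) : φ.1 l = 0 :=
  hφ.2 l (by simp [hl])

theorem gradedSymm_of_mem {n : ℕ} {G : Multi 𝒜 n} (hG : G ∈ C 𝒜 n) : GradedSymm G := hG.1

/-- This formula makes symmetry, the Leibniz rule, the momentum count, commutation and nilpotency of
`X φ` immediate. -/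
theorem X_val {φ : Multi 𝒜 (3 : ℕ)} (hφ : φ ∈ Cochain 𝒜 3) {n : ℤ} {G : Multi 𝒜 n}
    (hG : GradedSymm G) (l : List (Hom 𝒜)) : (X φ n G).1 l = -G.1 (⟨_, base φ⟩ :: l) := by
  change bracketFun φ G l = _
  rw [bracketFun_swap, bracketFun_cochain (cochain_val hφ), hG.val_append _ rfl]
  simp

theorem GradedSymm.X {φ : Multi 𝒜 (3 : ℕ)} (hφ : φ ∈ Cochain 𝒜 3) {n : ℤ} {G : Multi 𝒜 n}
    (hG : GradedSymm G) : GradedSymm (X φ n G) := by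
  intro l₁ l₂ a b
  rw [X_val hφ hG, X_val hφ hG, smul_neg, neg_inj]
  exact hG (_ :: l₁) l₂ a b

theorem X_mem_C {φ : Multi 𝒜 (3 : ℕ)} (hφ : φ ∈ Cochain 𝒜 3) {n : ℕ} {G : Multi 𝒜 n}
    (hG : G ∈ C 𝒜 n) : X φ n G ∈ C 𝒜 n := by
  have hs := gradedSymm_of_mem hG
  refine ⟨hs.X hφ, fun l j k a b => ?_, fun l hl => ?_⟩
  · rw [X_val hφ hs, X_val hφ hs, X_val hφ hs]
    have h := hG.2.1 (⟨_, base φ⟩ :: l) j k a b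
    -- Inserting a degree 3 argument does not change the degree, so the Leibniz signs for `G` and `X
    -- φ n G` agree.
    have hd : deg (n : ℤ) ((⟨_, base φ⟩ : Hom 𝒜) :: l) = deg (n : ℤ) l := by
      simp [deg]
    rw [hd] at h
    simp only [List.cons_append] at h
    rw [h, neg_add, neg_mul, mul_neg, smul_neg]
  · rw [X_val hφ hs, hG.2.2 _ (by simp only [List.length_cons]; omega), neg_zero]

theorem X_mem_BiC {φ : Multi 𝒜 (3 : ℕ)} (hφ : φ ∈ Cochain 𝒜 3) {n p q : ℕ} {G : Multi 𝒜 n}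
    (hG : G ∈ BiC 𝒜 n (p + 2) q) : X φ n G ∈ BiC 𝒜 n p (q + 2) := by
  refine ⟨X_mem_C hφ hG.1, fun l hl => ?_⟩
  rw [X_val hφ (gradedSymm_of_mem hG.1), hG.2 _ (by simp only [List.length_cons]; omega), neg_zero]

theorem X_cochain {φ : Multi 𝒜 (3 : ℕ)} (hφ : φ ∈ Cochain 𝒜 3) {n : ℕ} {G : Multi 𝒜 n}
    (hG : G ∈ Cochain 𝒜 n) : X φ n G = 0 :=
  Multi.ext fun l => by
    rw [X_val hφ (gradedSymm_of_mem hG.1), cochain_val hG _ (by simp), neg_zero, Multi.zero_val]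

theorem X_comm {φ ψ : Multi 𝒜 (3 : ℕ)} (hφ : φ ∈ Cochain 𝒜 3) (hψ : ψ ∈ Cochain 𝒜 3) {n : ℤ}
    {G : Multi 𝒜 n} (hG : GradedSymm G) : X φ n (X ψ n G) = X ψ n (X φ n G) :=
  Multi.ext fun l => by
    rw [X_val hφ (hG.X hψ), X_val hψ (hG.X hφ), X_val hψ hG, X_val hφ hG]
    have h := hG [] l ⟨_, base ψ⟩ ⟨_, base φ⟩
    simp only [List.nil_append] at h
    rw [h]
    simp

/-- Three insertions would need three momenta, but degree 4 allows at most two. Distinct functions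
are allowed for the mixed cubic terms in `expX_expX`. -/
theorem X_X_X {φ ψ χ : Multi 𝒜 (3 : ℕ)} (hφ : φ ∈ Cochain 𝒜 3) (hψ : ψ ∈ Cochain 𝒜 3)
    (hχ : χ ∈ Cochain 𝒜 3) {G : Multi 𝒜 (4 : ℕ)} (hG : G ∈ C 𝒜 4) :
    X φ _ (X ψ _ (X χ _ G)) = 0 :=
  Multi.ext fun l => by
    have hs := gradedSymm_of_mem hG
    rw [X_val hφ ((hs.X hχ).X hψ), X_val hψ (hs.X hχ), X_val hχ hs,
      hG.2.2 _ (by simp only [List.length_cons]; omega), neg_zero, neg_zero, neg_zero,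
      Multi.zero_val]

/-! ### The exponential of `X_φ` and the master equation -/

theorem X_pow_eq_zero {φ : Multi 𝒜 (3 : ℕ)} (hφ : φ ∈ Cochain 𝒜 3) {G : Multi 𝒜 (4 : ℕ)}
    (hG : G ∈ C 𝒜 4) {i : ℕ} (hi : 3 ≤ i) : (X φ (4 : ℕ) ^ i) G = 0 := by
  obtain ⟨j, rfl⟩ := Nat.exists_eq_add_of_le' hi
  rw [pow_add, Module.End.mul_apply]
  have : (X φ (4 : ℕ) ^ 3) G = 0 := X_X_X hφ hφ hφ hG
  rw [this, map_zero]

theorem expX_eq {φ : Multi 𝒜 (3 : ℕ)} (hφ : φ ∈ Cochain 𝒜 3) {G : Multi 𝒜 (4 : ℕ)}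
    (hG : G ∈ C 𝒜 4) :
    expX φ G = G + X φ _ G + (1 / 2 : ℝ) • X φ _ (X φ _ G) := by
  unfold expX
  rw [finsum_eq_sum_of_support_subset (s := Finset.range 3)]
  · simp [Finset.sum_range_succ, pow_two]
  · intro i hi
    by_contra h
    exact hi (by simp only [X_pow_eq_zero hφ hG (by simpa using h), smul_zero])

/-- This is the Jacobi identity with first entry `φ`, whose shifted degree zero makes the sign
trivial. -/
theorem X_bracket {φ : Multi 𝒜 (3 : ℕ)} (hφ : φ ∈ Cochain 𝒜 3) {f g n : ℤ} (hn : n = f + g - 3)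
    {F : Multi 𝒜 f} {G : Multi 𝒜 g} (hF : GradedSymm F) (hG : GradedSymm G) :
    X φ n (bracket n hn F G) = bracket n hn (X φ f F) G + bracket n hn F (X φ g G) :=
  Multi.ext fun l => by
    refine (bracketFun_jacobi l (p := f) (r := g) (by norm_num) hn (by norm_num)
      (gradedSymm_of_mem hφ.1) hF hG).trans ?_
    simp [X, Multi.add_val, bracket_val]

theorem expX_mem_C {φ : Multi 𝒜 (3 : ℕ)} (hφ : φ ∈ Cochain 𝒜 3) {G : Multi 𝒜 (4 : ℕ)}
    (hG : G ∈ C 𝒜 4) : expX φ G ∈ C 𝒜 4 := by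
  rw [expX_eq hφ hG]
  exact add_mem (add_mem hG (X_mem_C hφ hG))
    (Submodule.smul_mem _ _ (X_mem_C hφ (X_mem_C hφ hG)))

theorem IsQStructure.expX {φ : Multi 𝒜 (3 : ℕ)} (hφ : φ ∈ Cochain 𝒜 3) {Θ : Multi 𝒜 (4 : ℕ)}
    (hΘ : IsQStructure 𝒜 Θ) : IsQStructure 𝒜 (expX φ Θ) := by
  obtain ⟨hC, h₀₀⟩ := hΘ
  refine ⟨expX_mem_C hφ hC, ?_⟩
  rw [expX_eq hφ hC]
  have s₀ := gradedSymm_of_mem hC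
  have s₁ := s₀.X hφ
  have s₂ := s₁.X hφ
  have h₃ := X_X_X hφ hφ hφ hC
  -- With `Θᵢ = X_φⁱ Θ` and `Θ₃ = 0`, applying `X_φ` repeatedly to `{Θ, Θ} = 0` gives in turn `{Θ,
  -- Θ₁} = 0`, `{Θ₁, Θ₁} + {Θ, Θ₂} = 0`, `{Θ₁, Θ₂} = 0` and `{Θ₂, Θ₂} = 0`.
  have d₀₀ := X_bracket hφ (n := 5) (by norm_num) s₀ s₀
  have d₀₁ := X_bracket hφ (n := 5) (by norm_num) s₀ s₁
  have d₀₂ := X_bracket hφ (n := 5) (by norm_num) s₀ s₂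
  have d₁₁ := X_bracket hφ (n := 5) (by norm_num) s₁ s₁
  have d₁₂ := X_bracket hφ (n := 5) (by norm_num) s₁ s₂
  rw [h₃] at d₀₂ d₁₂
  generalize X φ _ (X φ _ Θ) = Θ₂ at *
  generalize X φ _ Θ = Θ₁ at *
  rw [bracket_four_comm Θ₁ Θ, h₀₀, map_zero] at d₀₀
  have h₀₁ : bracket 5 (by norm_num) Θ Θ₁ = 0 := by
    linear_combination (norm := module) (-(1 / 2 : ℝ)) • d₀₀
  rw [h₀₁, map_zero] at d₀₁
  have d := congrArg (X φ 5) d₀₁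
  rw [map_zero, map_add, d₁₁, d₀₂, map_zero, bracket_four_comm Θ₂ Θ₁] at d
  -- Differentiating the previous relation yields three equal copies of `{Θ₁, Θ₂}`.
  have h₁₂ : bracket 5 (by norm_num) Θ₁ Θ₂ = 0 := by
    linear_combination (norm := module) (-(1 / 3 : ℝ)) • d
  rw [h₁₂, map_zero, map_zero, add_zero] at d₁₂
  simp only [map_add, map_smul, LinearMap.add_apply, LinearMap.smul_apply]
  rw [bracket_four_comm Θ₁ Θ, bracket_four_comm Θ₂ Θ, bracket_four_comm Θ₂ Θ₁, h₀₀, h₀₁, h₁₂,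
    ← d₁₂]
  -- Only `{Θ₁, Θ₁} + {Θ, Θ₂}` is left; the coefficient of `{Θ, Θ₂}` is `1/2 + 1/2`.
  linear_combination (norm := module) (-(1 : ℝ)) • d₀₁

theorem expX_zero {G : Multi 𝒜 (4 : ℕ)} (hG : G ∈ C 𝒜 4) : expX (0 : Multi 𝒜 (3 : ℕ)) G = G := by
  rw [expX_eq (zero_mem _) hG]
  simp [X]

theorem expX_expX {φ ψ : Multi 𝒜 (3 : ℕ)} (hφ : φ ∈ Cochain 𝒜 3) (hψ : ψ ∈ Cochain 𝒜 3)
    {G : Multi 𝒜 (4 : ℕ)} (hG : G ∈ C 𝒜 4) : expX ψ (expX φ G) = expX (φ + ψ) G := by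
  rw [expX_eq hψ (expX_mem_C hφ hG), expX_eq (add_mem hφ hψ) hG, expX_eq hφ hG]
  have h := X_comm hψ hφ (gradedSymm_of_mem hG)
  simp only [X_add, map_add, map_smul, LinearMap.add_apply, X_X_X hψ hφ hφ hG,
    h, X_X_X hψ hφ hψ hG, map_zero]
  module

theorem twist_equivalence : Equivalence (Twist (𝒜 := 𝒜)) where
  refl Θ := ⟨0, zero_mem _, (expX_zero Θ.2.1).symm⟩
  symm := by
    rintro Θ Θ' ⟨φ, hφ, h⟩
    refine ⟨-φ, neg_mem hφ, ?_⟩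
    rw [h, expX_expX hφ (neg_mem hφ) Θ.2.1, add_neg_cancel, expX_zero Θ.2.1]
  trans := by
    rintro Θ Θ' Θ'' ⟨φ, hφ, h⟩ ⟨ψ, hψ, h'⟩
    exact ⟨φ + ψ, add_mem hφ hψ, by rw [h', h, expX_expX hφ hψ Θ.2.1]⟩

end Hamiltonian

section Classification

variable {A : Type*} [Ring A] [Algebra ℝ A] {𝒜 : ℤ → Submodule ℝ A}

/-! ### Decomposition by the number of momenta -/

/-- The part of a family having exactly `m` momenta. -/
def momentumPart (m : ℕ) {n : ℤ} (G : Multi 𝒜 n) : Multi 𝒜 n :=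
  ⟨fun l => if l.length = m then G.1 l else 0, by
    refine ⟨fun l => ?_, fun l₁ l₂ k a b => ?_, fun l₁ l₂ k c a => ?_⟩
    · beta_reduce
      split_ifs
      · exact G.2.1 l
      · exact Submodule.zero_mem _
    · simp only [List.length_append, List.length_cons]
      split_ifs
      · exact G.2.2.1 l₁ l₂ k a b
      · simp
    · simp only [List.length_append, List.length_cons]
      split_ifs
      · exact G.2.2.2 l₁ l₂ k c a
      · simp⟩

theorem momentumPart_val (m : ℕ) {n : ℤ} (G : Multi 𝒜 n) (l : List (Hom 𝒜)) :
    (momentumPart m G).1 l = if l.length = m then G.1 l else 0 := rfl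

theorem momentumPart_add (m : ℕ) {n : ℤ} (F G : Multi 𝒜 n) :
    momentumPart m (F + G) = momentumPart m F + momentumPart m G :=
  Multi.ext fun l => by
    simp only [Multi.add_val, momentumPart_val]
    split_ifs <;> simp

variable [SetLike.GradedMul 𝒜]

/-- Symmetry and the Leibniz rule only compare values on lists of equal length, so truncation by
length preserves them. -/
theorem momentumPart_mem_BiC {n p q : ℕ} (m : ℕ) (hp : 2 * m = p) (hn : p + q = n)
    {G : Multi 𝒜 n} (hG : G ∈ C 𝒜 n) : momentumPart m G ∈ BiC 𝒜 n p q := by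
  refine ⟨⟨fun l₁ l₂ a b => ?_, fun l j k a b => ?_, fun l hl => ?_⟩, fun l hl => ?_⟩
  · simp only [momentumPart_val, List.length_append, List.length_cons]
    split_ifs
    · exact hG.1 l₁ l₂ a b
    · simp
  · simp only [momentumPart_val, List.length_append, List.length_cons]
    split_ifs
    · exact hG.2.1 l j k a b
    · simp
  · rw [momentumPart_val, hG.2.2 l hl, ite_self]
  · rw [momentumPart_val, if_neg (by omega)]

theorem BiC_val {n p q m : ℕ} (hp : 2 * m = p) {G : Multi 𝒜 n} (hG : G ∈ BiC 𝒜 n p q)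
    (l : List (Hom 𝒜)) (hl : l.length ≠ m) : G.1 l = 0 :=
  hG.2 l (by omega)

theorem eq_add_momentumParts {G : Multi 𝒜 (4 : ℕ)} (hG : G ∈ C 𝒜 4) :
    G = momentumPart 2 G + momentumPart 1 G + momentumPart 0 G :=
  Multi.ext fun l => by
    simp only [Multi.add_val, momentumPart_val]
    by_cases h : 4 < 2 * l.length
    · simp [hG.2.2 l h]
    · have : l.length = 0 ∨ l.length = 1 ∨ l.length = 2 := by omega
      rcases this with h | h | h <;> simp [h]

theorem momentumPart_of_mem {n p q m : ℕ} (hp : 2 * m = p) {G : Multi 𝒜 n}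
    (hG : G ∈ BiC 𝒜 n p q) (k : ℕ) : momentumPart k G = if k = m then G else 0 :=
  Multi.ext fun l => by
    rw [momentumPart_val]
    by_cases hk : k = m
    · rw [if_pos hk]
      split_ifs with h
      · rfl
      · exact (BiC_val hp hG l (hk ▸ h)).symm
    · rw [if_neg hk, Multi.zero_val]
      split_ifs with h
      · exact BiC_val hp hG l (h ▸ hk)
      · rfl

theorem momentumPart_sum {a b c : Multi 𝒜 (4 : ℕ)} (ha : a ∈ BiC 𝒜 4 4 0)
    (hb : b ∈ BiC 𝒜 4 2 2) (hc : c ∈ BiC 𝒜 4 0 4) :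
    momentumPart 2 (a + b + c) = a ∧ momentumPart 1 (a + b + c) = b ∧
      momentumPart 0 (a + b + c) = c := by
  simp only [momentumPart_add, momentumPart_of_mem (m := 2) rfl ha,
    momentumPart_of_mem (m := 1) rfl hb, momentumPart_of_mem (m := 0) rfl hc]
  simp

theorem existsUnique_decomposition (Θ : Multi 𝒜 (4 : ℕ)) (hΘ : Θ ∈ C 𝒜 4) :
    ∃! t : BiC 𝒜 4 4 0 × BiC 𝒜 4 2 2 × BiC 𝒜 4 0 4, Θ = t.1.1 + t.2.1.1 + t.2.2.1 := by
  have h₂ := momentumPart_mem_BiC (p := 4) (q := 0) 2 (by norm_num) (by norm_num) hΘ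
  have h₁ := momentumPart_mem_BiC (p := 2) (q := 2) 1 (by norm_num) (by norm_num) hΘ
  have h₀ := momentumPart_mem_BiC (p := 0) (q := 4) 0 (by norm_num) (by norm_num) hΘ
  refine ⟨⟨⟨_, h₂⟩, ⟨_, h₁⟩, ⟨_, h₀⟩⟩, eq_add_momentumParts hΘ, ?_⟩
  rintro ⟨⟨a, ha⟩, ⟨b, hb⟩, ⟨c, hc⟩⟩ h
  obtain ⟨e₂, e₁, e₀⟩ := momentumPart_sum ha hb hc
  change Θ = a + b + c at h
  subst h
  exact Prod.ext (Subtype.ext e₂.symm) (Prod.ext (Subtype.ext e₁.symm) (Subtype.ext e₀.symm))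

theorem decomposition_unique {b b' c c' : Multi 𝒜 (4 : ℕ)} (hb : b ∈ BiC 𝒜 4 2 2)
    (hb' : b' ∈ BiC 𝒜 4 2 2) (hc : c ∈ BiC 𝒜 4 0 4) (hc' : c' ∈ BiC 𝒜 4 0 4)
    (h : b + c = b' + c') : b = b' ∧ c = c' := by
  obtain ⟨-, h₁, h₂⟩ := momentumPart_sum (zero_mem _) hb hc
  obtain ⟨-, h₁', h₂'⟩ := momentumPart_sum (zero_mem _) hb' hc'
  rw [zero_add] at h₁ h₂ h₁' h₂'
  rw [h] at h₁ h₂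
  exact ⟨h₁.symm.trans h₁', h₂.symm.trans h₂'⟩

/-! ### Twisting and the differential -/

theorem mem_C_of_sum (θ₂ : BiC 𝒜 4 4 0) (θ₁₃ : BiC 𝒜 4 2 2) (θ₄ : BiC 𝒜 4 0 4) :
    θ₂.1 + θ₁₃.1 + θ₄.1 ∈ C 𝒜 4 :=
  add_mem (add_mem θ₂.2.1 θ₁₃.2.1) θ₄.2.1

/-- Each `X_φ` trades one momentum for base degree 2, so the terms of `exp(X_φ)` are sorted by
bidegree. The minus signs come from `{G, φ} = -X_φ G`. -/
theorem expX_components (θ₂ : BiC 𝒜 4 4 0) (θ₁₃ : BiC 𝒜 4 2 2) (θ₄ : BiC 𝒜 4 0 4)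
    (φ : BiC 𝒜 3 0 3) :
    ∃ (θ₁₃' : BiC 𝒜 4 2 2) (θ₄' : BiC 𝒜 4 0 4),
        expX φ.1 (θ₂.1 + θ₁₃.1 + θ₄.1) = θ₂.1 + θ₁₃'.1 + θ₄'.1 ∧
        θ₁₃'.1 = θ₁₃.1 - bracket (4 : ℕ) (by norm_num) θ₂.1 φ.1 ∧
        θ₄'.1 = θ₄.1 - bracket (4 : ℕ) (by norm_num) θ₁₃.1 φ.1
          + (1 / 2 : ℝ) • bracket (4 : ℕ) (by norm_num)
              (bracket (4 : ℕ) (by norm_num) θ₂.1 φ.1) φ.1 := by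
  have m₂ := X_mem_BiC φ.2 θ₂.2
  have m₁₃ := X_mem_BiC φ.2 θ₁₃.2
  refine ⟨⟨θ₁₃.1 + X φ.1 _ θ₂.1, add_mem θ₁₃.2 m₂⟩,
    ⟨θ₄.1 + X φ.1 _ θ₁₃.1 + (1 / 2 : ℝ) • X φ.1 _ (X φ.1 _ θ₂.1),
      add_mem (add_mem θ₄.2 m₁₃) (Submodule.smul_mem _ _ (X_mem_BiC φ.2 m₂))⟩, ?_, ?_, ?_⟩
  · rw [expX_eq φ.2 (mem_C_of_sum θ₂ θ₁₃ θ₄)]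
    simp only [map_add, X_cochain φ.2 θ₄.2, X_cochain φ.2 m₁₃, add_zero]
    abel
  · rw [bracket_cochain, sub_neg_eq_add]
  · simp only [bracket_cochain, sub_neg_eq_add, map_neg, LinearMap.neg_apply, neg_neg]

theorem δ_three_val (θ : BiC 𝒜 4 2 2) (φ : Cochain 𝒜 3) : (δ θ 3 φ).1 = -X φ.1 (4 : ℕ) θ.1 :=
  bracket_cochain θ.1

theorem bracket_four_val (θ : BiC 𝒜 4 2 2) (α : Cochain 𝒜 4) :
    bracket 5 (by norm_num) θ.1 α.1 = (δ θ 4 α).1 := rfl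

theorem expX_of_no_quadratic_part (θ₁₃ : BiC 𝒜 4 2 2) (θ₄ : BiC 𝒜 4 0 4) (φ : BiC 𝒜 3 0 3) :
    expX φ.1 (θ₁₃.1 + θ₄.1) = θ₁₃.1 + (θ₄ - δ θ₁₃ 3 φ : Cochain 𝒜 4).1 := by
  have e : (θ₄ - δ θ₁₃ 3 φ : Cochain 𝒜 4).1 = θ₄.1 + X φ.1 (4 : ℕ) θ₁₃.1 := by
    change θ₄.1 - (δ θ₁₃ 3 φ).1 = _
    rw [δ_three_val, sub_neg_eq_add]
  rw [e, expX_eq φ.2 (add_mem θ₁₃.2.1 θ₄.2.1)]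
  simp only [map_add, X_cochain φ.2 θ₄.2, X_cochain φ.2 (X_mem_BiC φ.2 θ₁₃.2), add_zero,
    smul_zero]
  abel

theorem isQStructure_iff (θ₁₃ : BiC 𝒜 4 2 2) (θ₄ : BiC 𝒜 4 0 4) :
    IsQStructure 𝒜 (θ₁₃.1 + θ₄.1) ↔
      bracket 5 (by norm_num) θ₁₃.1 θ₁₃.1 = 0 ∧ δ θ₁₃ 4 θ₄ = 0 := by
  have h₄ : bracket 5 (by norm_num) θ₄.1 θ₄.1 = 0 := Multi.ext fun l =>
    bracketFun_base l _ _ (cochain_val θ₄.2) (cochain_val θ₄.2)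
  have e : bracket 5 (by norm_num) (θ₁₃.1 + θ₄.1) (θ₁₃.1 + θ₄.1) =
      bracket 5 (by norm_num) θ₁₃.1 θ₁₃.1 + (2 : ℝ) • bracket 5 (by norm_num) θ₁₃.1 θ₄.1 := by
    simp only [map_add, LinearMap.add_apply, h₄, bracket_four_comm θ₄.1 θ₁₃.1]
    module
  constructor
  · rintro ⟨-, h⟩
    rw [e] at h
    -- The two summands of `{Θ, Θ}` are supported on lists of length 1 and 0 respectively, so they
    -- vanish separately.
    have h₁ : ∀ l : List (Hom 𝒜), l.length ≠ 1 → bracketFun θ₁₃.1 θ₁₃.1 l = 0 := fun l hl =>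
      bracketFun_eq_zero_of_length l (p := 1) (q := 1) (BiC_val rfl θ₁₃.2) (BiC_val rfl θ₁₃.2)
        (by omega)
    have h₂ : ∀ l : List (Hom 𝒜), l.length ≠ 0 → bracketFun θ₁₃.1 θ₄.1 l = 0 := fun l hl =>
      bracketFun_eq_zero_of_length l (p := 1) (q := 0) (BiC_val rfl θ₁₃.2) (BiC_val rfl θ₄.2)
        (by omega)
    have h₃ : bracket 5 (by norm_num) θ₁₃.1 θ₄.1 = 0 := Multi.ext fun l => by
      by_cases hl : l.length = 0
      · have := congrArg (fun G : Multi 𝒜 5 => G.1 l) h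
        simp only [Multi.add_val, Multi.smul_val, Multi.zero_val, bracket_val, h₁ l (by omega),
          zero_add, smul_eq_zero, OfNat.ofNat_ne_zero, false_or] at this
        exact this
      · exact h₂ l hl
    refine ⟨?_, Subtype.ext h₃⟩
    rw [h₃, smul_zero, add_zero] at h
    exact h
  · rintro ⟨h₁, h₂⟩
    refine ⟨add_mem θ₁₃.2.1 θ₄.2.1, ?_⟩
    rw [e, h₁, bracket_four_val, h₂]
    simp

theorem twist_iff (Θ Θ' : QStructure 𝒜) (θ₁₃ θ₁₃' : BiC 𝒜 4 2 2) (θ₄ θ₄' : BiC 𝒜 4 0 4)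
    (h : Θ.1 = θ₁₃.1 + θ₄.1) (h' : Θ'.1 = θ₁₃'.1 + θ₄'.1) :
    Twist Θ Θ' ↔ θ₁₃ = θ₁₃' ∧ ∃ φ : BiC 𝒜 3 0 3, θ₄ - θ₄' = δ θ₁₃ 3 φ := by
  constructor
  · rintro ⟨φ, hφ, e⟩
    rw [h, h', expX_of_no_quadratic_part θ₁₃ θ₄ ⟨φ, hφ⟩] at e
    obtain ⟨e₁, e₂⟩ := decomposition_unique θ₁₃'.2 θ₁₃.2 θ₄'.2 (Subtype.prop _) e
    refine ⟨Subtype.ext e₁.symm, ⟨φ, hφ⟩, ?_⟩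
    rw [show θ₄' = θ₄ - δ θ₁₃ 3 ⟨φ, hφ⟩ from Subtype.ext e₂]
    exact sub_sub_cancel _ _
  · rintro ⟨rfl, φ, e⟩
    refine ⟨φ.1, φ.2, ?_⟩
    rw [h, h', expX_of_no_quadratic_part, ← e]
    congr 2
    exact (sub_sub_cancel _ _).symm

/-! ### The complex and its fourth cohomology -/

theorem δ_comp_δ (θ : BiC 𝒜 4 2 2) (hθ : bracket 5 (by norm_num) θ.1 θ.1 = 0) (k : ℕ) :
    δ θ (k + 1) ∘ₗ δ θ k = 0 := by
  refine LinearMap.ext fun α => Subtype.ext (Multi.ext fun l => ?_)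
  have hs := gradedSymm_of_mem θ.2.1
  have h := bracketFun_jacobi l (p := 5) (q := ((k + 1 : ℕ) : ℤ)) (r := ((k + 1 : ℕ) : ℤ))
    (by norm_num) (by push_cast; ring) (by push_cast; ring) hs hs (gradedSymm_of_mem α.2.1)
  rw [hθ, bracketFun_zero_left, zero_add] at h
  -- Since `θ` has odd shifted degree, Jacobi reads `δ²α = -δ²α` once `{θ, θ} = 0`.
  have hu : ((((4 : ℕ) : ℤ) - 3) * (((4 : ℕ) : ℤ) - 3)).negOnePow = -1 := by norm_num
  rw [hu, Units.neg_smul, one_smul] at h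
  have h₂ := eq_neg_iff_add_eq_zero.1 h
  rw [← two_smul ℝ, smul_eq_zero] at h₂
  exact h₂.resolve_left two_ne_zero

/-- The twisting classes of Q-structures over `θ` are the cohomology classes of degree `4`. -/
theorem exists_equiv_H (θ : BiC 𝒜 4 2 2) (hθ : bracket 5 (by norm_num) θ.1 θ.1 = 0) :
    ∃ e : Quot (fun Θ Θ' : QStructureOver θ => Twist Θ.1 Θ'.1) ≃ H θ 3,
      ∀ (Θ : QStructureOver θ) (θ₄ : BiC 𝒜 4 0 4) (hθ₄ : δ θ 4 θ₄ = 0),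
        Θ.1.1 = θ.1 + θ₄.1 → e (Quot.mk _ Θ) = Submodule.Quotient.mk ⟨θ₄, hθ₄⟩ := by
  -- The `θ₄`-part is unique by `decomposition_unique`, so this choice is canonical; `hval` records
  -- it.
  choose part hpart using fun Θ : QStructureOver θ => Θ.2
  have hker (Θ : QStructureOver θ) : δ θ 4 (part Θ) = 0 :=
    ((isQStructure_iff θ (part Θ)).1 (hpart Θ ▸ Θ.1.2)).2
  have hmk (a b : LinearMap.ker (δ θ (3 + 1))) :
      (Submodule.Quotient.mk a : H θ 3) = Submodule.Quotient.mk b ↔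
        ∃ φ : BiC 𝒜 3 0 3, a.1 - b.1 = δ θ 3 φ := by
    rw [Submodule.Quotient.eq]
    exact ⟨fun ⟨φ, h⟩ => ⟨φ, h.symm⟩, fun ⟨φ, h⟩ => ⟨φ, h.symm⟩⟩
  -- Twisting is exactly equality of the classes of the `θ₄`-parts: one direction makes `toH` well
  -- defined, the other makes it injective.
  have htw (Θ Θ' : QStructureOver θ) : Twist Θ.1 Θ'.1 ↔
      (Submodule.Quotient.mk ⟨part Θ, hker Θ⟩ : H θ 3) =
        Submodule.Quotient.mk ⟨part Θ', hker Θ'⟩ := by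
    rw [twist_iff Θ.1 Θ'.1 θ θ (part Θ) (part Θ') (hpart Θ) (hpart Θ'), hmk]
    simp
  have hval (Θ : QStructureOver θ) (θ₄ : BiC 𝒜 4 0 4) (h : Θ.1.1 = θ.1 + θ₄.1) :
      part Θ = θ₄ :=
    Subtype.ext (decomposition_unique θ.2 θ.2 (part Θ).2 θ₄.2 ((hpart Θ).symm.trans h)).2
  let toH : Quot (fun Θ Θ' : QStructureOver θ => Twist Θ.1 Θ'.1) → H θ 3 :=
    Quot.lift (fun Θ => Submodule.Quotient.mk ⟨part Θ, hker Θ⟩) fun Θ Θ' h => (htw Θ Θ').1 h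
  have hbij : Function.Bijective toH := by
    constructor
    · rintro ⟨Θ⟩ ⟨Θ'⟩ h
      exact Quot.sound ((htw Θ Θ').2 h)
    · intro x
      obtain ⟨⟨θ₄, h₄⟩, rfl⟩ := Submodule.Quotient.mk_surjective _ x
      -- Every cocycle `θ₄` occurs, because `θ + θ₄` then solves the master equation.
      let Θ : QStructureOver θ :=
        ⟨⟨θ.1 + θ₄.1, (isQStructure_iff θ θ₄).2 ⟨hθ, h₄⟩⟩, θ₄, rfl⟩
      refine ⟨Quot.mk _ Θ, ?_⟩
      exact congrArg Submodule.Quotient.mk (Subtype.ext (hval Θ θ₄ rfl))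
  refine ⟨Equiv.ofBijective toH hbij, fun Θ θ₄ hθ₄ h => ?_⟩
  exact congrArg Submodule.Quotient.mk (Subtype.ext (hval Θ θ₄ h))

end Classification

end ShiftedCotangent

end

open ShiftedCotangent in
theorem mainTheorem2 (d : ℕ) {M : Type*} [TopologicalSpace M] [T2Space M]
    [SecondCountableTopology M] [ChartedSpace (EuclideanSpace ℝ (Fin d)) M] [IsManifold (𝓡 d) ∞ M]
    (F : Type*) [NormedAddCommGroup F] [NormedSpace ℝ F] [FiniteDimensional ℝ F]
    (E : M → Type*) [∀ x, AddCommGroup (E x)] [∀ x, Module ℝ (E x)] [∀ x, TopologicalSpace (E x)]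
    [TopologicalSpace (TotalSpace F E)] [FiberBundle F E] [VectorBundle ℝ F E]
    [ContMDiffVectorBundle ∞ F E (𝓡 d)] :
    -- `C⁴ = C^{4,0} ⊕ C^{2,2} ⊕ C^{0,4}`
    (∀ Θ ∈ C (Forms d F E) 4,
      ∃! t : BiC (Forms d F E) 4 4 0 × BiC (Forms d F E) 4 2 2 × BiC (Forms d F E) 4 0 4,
        Θ = t.1.1 + t.2.1.1 + t.2.2.1) ∧
    -- twisting a Q-structure `θ₂ + θ₁₃ + θ₄` by `φ` gives a Q-structure, with the stated components
    (∀ (θ₂ : BiC (Forms d F E) 4 4 0) (θ₁₃ : BiC (Forms d F E) 4 2 2) (θ₄ : BiC (Forms d F E) 4 0 4)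
      (φ : BiC (Forms d F E) 3 0 3), IsQStructure (Forms d F E) (θ₂.1 + θ₁₃.1 + θ₄.1) →
      IsQStructure (Forms d F E) (expX φ.1 (θ₂.1 + θ₁₃.1 + θ₄.1)) ∧
      (∀ i, 3 ≤ i → (X φ.1 (4 : ℕ) ^ i) (θ₂.1 + θ₁₃.1 + θ₄.1) = 0) ∧
      ∃ (θ₁₃' : BiC (Forms d F E) 4 2 2) (θ₄' : BiC (Forms d F E) 4 0 4),
        expX φ.1 (θ₂.1 + θ₁₃.1 + θ₄.1) = θ₂.1 + θ₁₃'.1 + θ₄'.1 ∧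
        θ₁₃'.1 = θ₁₃.1 - bracket (4 : ℕ) (by norm_num) θ₂.1 φ.1 ∧
        θ₄'.1 = θ₄.1 - bracket (4 : ℕ) (by norm_num) θ₁₃.1 φ.1
          + (1 / 2 : ℝ) • bracket (4 : ℕ) (by norm_num)
              (bracket (4 : ℕ) (by norm_num) θ₂.1 φ.1) φ.1) ∧
    -- twisting is an equivalence relation on the Q-structures
    Equivalence (Twist (𝒜 := Forms d F E)) ∧
    -- `θ₁₃ + θ₄` is a Q-structure iff `{θ₁₃, θ₁₃} = 0` and `δ θ₄ = 0`
    (∀ (θ₁₃ : BiC (Forms d F E) 4 2 2) (θ₄ : BiC (Forms d F E) 4 0 4),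
      IsQStructure (Forms d F E) (θ₁₃.1 + θ₄.1) ↔
        bracket 5 (by norm_num) θ₁₃.1 θ₁₃.1 = 0 ∧ δ θ₁₃ 4 θ₄ = 0) ∧
    -- if `θ₂ = 0`, then `θ₁₃` is unchanged and `θ₄` becomes `θ₄ - δ φ`
    (∀ (θ₁₃ : BiC (Forms d F E) 4 2 2) (θ₄ : BiC (Forms d F E) 4 0 4) (φ : BiC (Forms d F E) 3 0 3),
      IsQStructure (Forms d F E) (θ₁₃.1 + θ₄.1) →
      expX φ.1 (θ₁₃.1 + θ₄.1) = θ₁₃.1 + (θ₄ - δ θ₁₃ 3 φ : Cochain (Forms d F E) 4).1) ∧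
    -- two Q-structures without `θ₂` are equivalent iff they have the same `θ₁₃` and cohomologous `θ₄`
    (∀ (Θ Θ' : QStructure (Forms d F E)) (θ₁₃ θ₁₃' : BiC (Forms d F E) 4 2 2)
      (θ₄ θ₄' : BiC (Forms d F E) 4 0 4), Θ.1 = θ₁₃.1 + θ₄.1 → Θ'.1 = θ₁₃'.1 + θ₄'.1 →
      (Twist Θ Θ' ↔ θ₁₃ = θ₁₃' ∧ ∃ φ : BiC (Forms d F E) 3 0 3, θ₄ - θ₄' = δ θ₁₃ 3 φ)) ∧
    -- for fixed `θ₁₃`, `(Γ∧E*, δ)` is a complex and the twisting classes correspond to its `H⁴`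
    (∀ θ₁₃ : BiC (Forms d F E) 4 2 2, bracket 5 (by norm_num) θ₁₃.1 θ₁₃.1 = 0 →
      (∀ k, δ θ₁₃ (k + 1) ∘ₗ δ θ₁₃ k = 0) ∧
      ∃ e : Quot (fun Θ Θ' : QStructureOver θ₁₃ => Twist Θ.1 Θ'.1) ≃ H θ₁₃ 3,
        ∀ (Θ : QStructureOver θ₁₃) (θ₄ : BiC (Forms d F E) 4 0 4) (hθ₄ : δ θ₁₃ 4 θ₄ = 0),
          Θ.1.1 = θ₁₃.1 + θ₄.1 →
          e (Quot.mk _ Θ) = Submodule.Quotient.mk ⟨θ₄, hθ₄⟩) := by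
  refine ⟨existsUnique_decomposition, fun θ₂ θ₁₃ θ₄ φ h => ⟨h.expX φ.2,
    fun i hi => X_pow_eq_zero φ.2 (mem_C_of_sum θ₂ θ₁₃ θ₄) hi, expX_components θ₂ θ₁₃ θ₄ φ⟩,
    twist_equivalence, isQStructure_iff, fun θ₁₃ θ₄ φ _ => expX_of_no_quadratic_part θ₁₃ θ₄ φ,
    twist_iff, fun θ₁₃ h => ⟨δ_comp_δ θ₁₃ h, exists_equiv_H θ₁₃ h⟩⟩
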